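/- Let $F$ be a number field of degree $n$ over $\mathbb{Q}$, and let $w={}^t(w_1,\dots,w_n)\in F^n$ be a basis of $F$ over $\mathbb{Q}$. Let $S$ be a finite set of places of $\mathbb{Q}$ consisting of the archimedean place $\infty$ and of finitely many primes that are unramified in $F/\mathbb{Q}$. Let $N$ be the product of the primes in $S$ (so $N=1$ if $S=\{\infty\}$). Put $$\mathcal{A}_{w,S}=\{A\in M_n(\mathbb{Z}[1/N]) \mid \exists\,\lambda\in F,\ Aw=\lambda w\},\qquad \Gamma_{w,S}=\{A\in SL_n(\mathbb{Z}[1/N]) \mid \exists\,\lambda\in F,\ Aw=\lambda w\}.$$ For $A\in\mathcal{A}_{w,S}$ let $\varphi(A)\in F$ be the scalar with $Aw=\varphi(A)w$, and put $\mathcal{O}_{w,S}=\varphi(\mathcal{A}_{w,S})\subset F$. A $\mathbb{Z}[1/N]$-order in $F$ is a $\mathbb{Z}[1/N]$-subalgebra of $F$ that is finitely generated as a $\mathbb{Z}[1/N]$-module and spans $F$ over $\mathbb{Q}$. For a commutative group $G$, $\operatorname{rank}_{\mathbb{Z}}G$ is the supremum of the cardinalities of its $\mathbb{Z}$-linearly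 independent subsets. Then the following hold. (i) For every $A\in\mathcal{A}_{w,S}$ the scalar $\varphi(A)$ is unique, and $\varphi:\mathcal{A}_{w,S}\to F$ is an injective ring homomorphism. Its image $\mathcal{O}_{w,S}$ is a $\mathbb{Z}[1/N]$-order in $F$. With $\mathfrak{a}=\bigoplus_{i=1}^n\mathbb{Z}[1/N]w_i\subset F$ one has $\mathcal{O}_{w,S}=\{x\in F\mid x\mathfrak{a}\subset\mathfrak{a}\}$. (ii) $N_{F/\mathbb{Q}}(\varphi(A))=\det A$ for all $A\in\mathcal{A}_{w,S}$. (iii) The sequence of groups $1\to\Gamma_{w,S}\hookrightarrow\mathcal{A}_{w,S}^{\times}\xrightarrow{\det}\mathbb{Z}[1/N]^{\times}$ is exact. In particular, $\varphi$ induces an isomorphism of groups $\Gamma_{w,S}\simeq\mathcal{O}_{w,S}^1$, where $\mathcal{O}_{w,S}^1=\{x\in\mathcal{O}_{w,S}^{\times}\mid N_{F/\mathbb{Q}}(x)=1\}$. (iv) The group $\Gamma_{w,S}$ is commutative, and $$\operatorname{rank}_{\mathbb{Z}}\Gamma_{w,S}=\operatorname{rank}_{\mathbb{Z}}\mathcal{O}_{w,S}^{\times}-(\#S-1)=\sum_{p\in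 S}(g_p-1),$$ where $g_p$ is the number of places of $F$ above $p$ (for $p=\infty$, the number of archimedean places of $F$). -/

import Mathlib

namespace BasisOrder

/-- The ring `ℤ[1/N]`, as a subring of `ℚ`. -/
abbrev ZInv (N : ℕ) : Subalgebra ℤ ℚ := Algebra.adjoin ℤ {(N : ℚ)⁻¹}

/-- `N = ∏ p`, the product over the finite places `p ∈ S`. Throughout, a finite set of places of `ℚ`
that contains the infinite place is encoded by the finite set `S` of its finite places (primes). -/
abbrev level (S : Finset ℕ) : ℕ := ∏ p ∈ S, p

section

variable {F : Type*} [Field F] [NumberField F] {n : ℕ}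

/-- The relation `A w = c w` in `F ^ n`, for a matrix `A` over `ℤ[1/N]` and `c ∈ F`. -/
def ActsBy (N : ℕ) (w : Module.Basis (Fin n) ℚ F) (A : Matrix (Fin n) (Fin n) (ZInv N)) (c : F) :
    Prop :=
  (A.map (algebraMap (ZInv N) F)).mulVec (fun i => w i) = c • (fun i => w i)

section helpers

variable {N : ℕ} {w : Module.Basis (Fin n) ℚ F} {A B : Matrix (Fin n) (Fin n) (ZInv N)} {c d : F}

theorem ActsBy.mul (hA : ActsBy N w A c) (hB : ActsBy N w B d) : ActsBy N w (A * B) (c * d) := by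
  unfold ActsBy at *
  rw [Matrix.map_mul, ← Matrix.mulVec_mulVec, hB, Matrix.mulVec_smul, hA, smul_smul, mul_comm]

theorem ActsBy.add (hA : ActsBy N w A c) (hB : ActsBy N w B d) : ActsBy N w (A + B) (c + d) := by
  unfold ActsBy at *
  rw [Matrix.map_add _ (map_add _), Matrix.add_mulVec, hA, hB, add_smul]

theorem actsBy_algebraMap (r : ZInv N) :
    ActsBy N w (algebraMap (ZInv N) (Matrix (Fin n) (Fin n) (ZInv N)) r)
      (algebraMap (ZInv N) F r) := by
  unfold ActsBy
  ext i
  simp [Matrix.algebraMap_eq_diagonal, Matrix.diagonal_map, Matrix.mulVec_diagonal]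

theorem actsBy_one : ActsBy N w 1 1 := by
  simpa using actsBy_algebraMap (w := w) (1 : ZInv N)

theorem ActsBy.unique (hc : ActsBy N w A c) (hd : ActsBy N w A d) : c = d := by
  unfold ActsBy at *
  have hn : Nonempty (Fin n) := w.index_nonempty
  obtain ⟨i⟩ := hn
  have h := congrFun (hc.symm.trans hd) i
  exact mul_right_cancel₀ (w.ne_zero i) h

theorem ActsBy.ext (hA : ActsBy N w A c) (hB : ActsBy N w B c) : A = B := by
  have h := hA.trans hB.symm
  ext i j
  have hi := congrFun h i
  simp only [Matrix.mulVec, dotProduct, Matrix.map_apply] at hi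
  have key : ∑ j, ((A i j : ℚ) - (B i j : ℚ)) • w j = 0 := by
    rw [← sub_eq_zero] at hi
    rw [← hi, ← Finset.sum_sub_distrib]
    refine Finset.sum_congr rfl fun k _ => ?_
    rw [sub_smul, Algebra.smul_def, Algebra.smul_def]
    rfl
  exact sub_eq_zero.mp (Fintype.linearIndependent_iff.mp w.linearIndependent _ key j)

theorem ActsBy.inv {A : Matrix.SpecialLinearGroup (Fin n) (ZInv N)} (hA : ActsBy N w A.1 c) :
    ActsBy N w (A⁻¹).1 c⁻¹ := by
  have h1 : (A⁻¹).1 * A.1 = 1 := congrArg Subtype.val (inv_mul_cancel A)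
  unfold ActsBy at *
  have h2 : (fun i => w i) = c • ((A⁻¹).1.map (algebraMap (ZInv N) F)).mulVec (fun i => w i) := by
    have h3 := actsBy_one (N := N) (w := w)
    unfold ActsBy at h3
    rw [one_smul, ← h1, Matrix.map_mul, ← Matrix.mulVec_mulVec, hA, Matrix.mulVec_smul] at h3
    exact h3.symm
  have hc : c ≠ 0 := by
    rintro rfl
    obtain ⟨i⟩ : Nonempty (Fin n) := w.index_nonempty
    have h4 := congrFun h2 i
    rw [zero_smul] at h4
    exact w.ne_zero i h4
  conv_rhs => rw [h2, smul_smul, inv_mul_cancel₀ hc, one_smul]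

end helpers

/-- `𝓐_{w,S} = {A ∈ M_n(ℤ[1/N]) | ∃ c ∈ F, A w = c w}`. -/
def eigenAlgebra (N : ℕ) (w : Module.Basis (Fin n) ℚ F) :
    Subalgebra (ZInv N) (Matrix (Fin n) (Fin n) (ZInv N)) where
  carrier := {A | ∃ c : F, ActsBy N w A c}
  mul_mem' := by
    rintro A B ⟨c, hc⟩ ⟨d, hd⟩
    exact ⟨c * d, hc.mul hd⟩
  add_mem' := by
    rintro A B ⟨c, hc⟩ ⟨d, hd⟩
    exact ⟨c + d, hc.add hd⟩
  algebraMap_mem' r := ⟨_, actsBy_algebraMap r⟩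

/-- `Γ_{w,S} = {A ∈ SL_n(ℤ[1/N]) | ∃ c ∈ F, A w = c w}`. -/
def eigenGroup (N : ℕ) (w : Module.Basis (Fin n) ℚ F) :
    Subgroup (Matrix.SpecialLinearGroup (Fin n) (ZInv N)) where
  carrier := {A | ∃ c : F, ActsBy N w A.1 c}
  mul_mem' := by
    rintro A B ⟨c, hc⟩ ⟨d, hd⟩
    exact ⟨c * d, hc.mul hd⟩
  one_mem' := ⟨1, actsBy_one⟩
  inv_mem' := by
    rintro A ⟨c, hc⟩
    exact ⟨c⁻¹, hc.inv⟩

/-- `Γ_{w,S}` is commutative; this is needed to speak of its rank over `ℤ`. -/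
instance eigenGroup.instCommGroup (N : ℕ) (w : Module.Basis (Fin n) ℚ F) :
    CommGroup (eigenGroup N w) :=
  { (inferInstance : Group (eigenGroup N w)) with
    mul_comm := by
      rintro ⟨A, c, hA⟩ ⟨B, d, hB⟩
      apply Subtype.ext
      apply Subtype.ext
      exact (hA.mul hB).ext (mul_comm d c ▸ hB.mul hA) }

/-- The inclusion `Γ_{w,S} ⊆ 𝓐_{w,S}`. -/
def eigenGroup.toAlgebra (N : ℕ) (w : Module.Basis (Fin n) ℚ F) :
    eigenGroup N w →* eigenAlgebra N w where
  toFun A := ⟨A.1.1, A.2⟩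
  map_one' := rfl
  map_mul' _ _ := rfl

/-- The determinant `𝓐_{w,S}ˣ → ℤ[1/N]ˣ`. -/
def detUnits (N : ℕ) (w : Module.Basis (Fin n) ℚ F) : (eigenAlgebra N w)ˣ →* (ZInv N)ˣ :=
  Units.map (Matrix.detMonoidHom.comp (eigenAlgebra N w).val.toMonoidHom)

/-- `φ : 𝓐_{w,S} → F`, where `φ A` is the scalar such that `A w = φ(A) w`. -/
noncomputable def phi (N : ℕ) (w : Module.Basis (Fin n) ℚ F) (A : eigenAlgebra N w) : F :=
  Classical.choose A.2

theorem phi_spec (N : ℕ) (w : Module.Basis (Fin n) ℚ F) (A : eigenAlgebra N w) :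
    ActsBy N w A.1 (phi N w A) :=
  Classical.choose_spec A.2

/-- `𝓞_{w,S} = φ(𝓐_{w,S})`, the image of `φ` (it is a `ℤ[1/N]`-subalgebra of `F`). -/
def order (N : ℕ) (w : Module.Basis (Fin n) ℚ F) : Subalgebra (ZInv N) F where
  carrier := Set.range (phi N w)
  mul_mem' := by
    rintro _ _ ⟨A, rfl⟩ ⟨B, rfl⟩
    exact ⟨A * B, (phi_spec N w (A * B)).unique ((phi_spec N w A).mul (phi_spec N w B))⟩
  add_mem' := by
    rintro _ _ ⟨A, rfl⟩ ⟨B, rfl⟩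
    exact ⟨A + B, (phi_spec N w (A + B)).unique ((phi_spec N w A).add (phi_spec N w B))⟩
  algebraMap_mem' r :=
    ⟨algebraMap (ZInv N) (eigenAlgebra N w) r, (phi_spec N w _).unique (actsBy_algebraMap r)⟩

/-- A `ℤ[1/N]`-order in `F`: a `ℤ[1/N]`-subalgebra that is finitely generated as a
`ℤ[1/N]`-module and spans `F` over `ℚ`. -/
structure IsOrder {N : ℕ} (O : Subalgebra (ZInv N) F) : Prop where
  finite : Module.Finite (ZInv N) O
  span_eq_top : Submodule.span ℚ (O : Set F) = ⊤

/-- The lattice `𝔞 = ⨁ ℤ[1/N] w_i ⊆ F` (the sum is direct, as the `w_i` are independent over `ℚ`). -/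
def lattice (N : ℕ) (w : Module.Basis (Fin n) ℚ F) : Submodule (ZInv N) F :=
  Submodule.span (ZInv N) (Set.range w)

/-- `𝓞¹ = {x ∈ 𝓞ˣ | N_{F/ℚ}(x) = 1}`. -/
noncomputable def normOneUnits {N : ℕ} (O : Subalgebra (ZInv N) F) : Subgroup Oˣ :=
  ((Algebra.norm ℚ : F →* ℚ).comp (O.val.toMonoidHom.comp (Units.coeHom O))).ker

end

/-- The rank over `ℤ` of a (multiplicative) commutative group, as a cardinal: the supremum of the
cardinalities of its `ℤ`-linearly independent subsets. -/
noncomputable abbrev zRank (G : Type*) [CommGroup G] : Cardinal := Module.rank ℤ (Additive G)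

/-- `g_p`: the number of places of `F` above the prime number `p`. -/
noncomputable def placesAbove (F : Type*) [Field F] [NumberField F] (p : ℕ) : ℕ :=
  {v : NumberField.FinitePlace F | v (p : F) < 1}.ncard

end BasisOrder

namespace BasisOrder

-- Ranks of commutative groups

universe u v

/-! The relation `A w = c w` says that `A` is the transpose of the matrix of multiplication by `c`
in the basis `w`. Hence `φ` identifies the matrices with the `x ∈ F` whose multiplication matrix has
entries in `ℤ[1/N]`, that is, with the multiplier ring of the lattice. Determinants become norms,
and `Γ` becomes the group of units of norm one (`actsBy_iff_toMatrix`, `norm_phi`,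
`eigenGroupEquiv`).

The rank of `Oˣ` is computed in two ways, by maps to free groups with image of finite index. The
valuations at the primes above `N` have a kernel commensurable with the units of `𝓞 F`, to which
Dirichlet's theorem applies (`IsOrder.zRank_units`). The valuations of the norm at `p ∈ S` have as
kernel the units of norm `±1` (`IsOrder.zRank_units_eq_zRank_normOneUnits_add`). Comparing the two
gives the rank of `Γ`.

That an arbitrary order has enough units rests on `IsOrder.exists_unit_eq_pow`. The order contains
`c • 𝓞 F` with `c` prime to `N`, and divisors of powers of `N` are invertible modulo `c`, so some
power of each is `1` modulo `c`. -/

theorem rank_eq_of_torsion_quotient {M : Type*} [AddCommGroup M] (p : Submodule ℤ M)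
    (h : ∀ x : M, ∃ k : ℤ, k ≠ 0 ∧ k • x ∈ p) : Module.rank ℤ p = Module.rank ℤ M := by
  rw [← rank_quotient_add_rank_of_isDomain p]
  have : Module.rank ℤ (M ⧸ p) = 0 := by
    rw [rank_eq_zero_iff]
    intro x
    obtain ⟨x, rfl⟩ := p.mkQ_surjective x
    obtain ⟨k, hk, hx⟩ := h x
    refine ⟨k, hk, ?_⟩
    rw [← map_smul]
    exact (Submodule.Quotient.mk_eq_zero p).mpr hx
  rw [this, zero_add]

/-- An injective homomorphism with torsion cokernel preserves the rank. -/
theorem lift_zRank_eq_of_injective {G : Type u} {H : Type v} [CommGroup G] [CommGroup H]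
    (f : G →* H) (hf : Function.Injective f) (h : ∀ y : H, ∃ k : ℕ, k ≠ 0 ∧ ∃ x, f x = y ^ k) :
    Cardinal.lift.{u} (zRank H) = Cardinal.lift.{v} (zRank G) := by
  have hinj : Function.Injective f.toAdditive.toIntLinearMap := hf
  rw [← LinearMap.lift_rank_range_add_rank_ker f.toAdditive.toIntLinearMap,
    LinearMap.ker_eq_bot.mpr hinj,
    rank_eq_of_torsion_quotient (LinearMap.range f.toAdditive.toIntLinearMap)]
  · simp
  · intro y
    obtain ⟨k, hk, x, hx⟩ := h y.toMul
    refine ⟨k, by exact_mod_cast hk, Additive.ofMul x, ?_⟩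
    rw [natCast_zsmul]
    exact congrArg Additive.ofMul hx

/-- The rank of a group mapping onto a finite index subgroup of `ℤ ^ ι`. -/
theorem zRank_eq_zRank_ker_add {G : Type u} {ι : Type v} [CommGroup G] [Finite ι]
    (f : G →* Multiplicative (ι → ℤ))
    (h : ∀ i, ∃ x, (f x).toAdd i ≠ 0 ∧ ∀ j ≠ i, (f x).toAdd j = 0) :
    zRank G = zRank f.ker + (Nat.card ι : Cardinal) := by
  classical
  have := Fintype.ofFinite ι
  have h1 : Module.rank ℤ (LinearMap.range f.toAdditive.toIntLinearMap) = Nat.card ι := by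
    trans Module.rank ℤ (ι → ℤ)
    · choose x hc hx using h
      set c : ι → ℤ := fun i => (f (x i)).toAdd i with hcd
      refine rank_eq_of_torsion_quotient (M := ι → ℤ) _ fun y => ⟨∏ i, c i, ?_, ?_⟩
      · exact Finset.prod_ne_zero_iff.mpr fun i _ => hc i
      · have : (∏ i, c i) • y =
            ∑ i, (y i * ∏ j ∈ Finset.univ.erase i, c j) • ((f (x i)).toAdd : ι → ℤ) := by
          ext j
          rw [Finset.sum_apply, Finset.sum_eq_single j]
          · simp only [Pi.smul_apply, smul_eq_mul]
            rw [← Finset.mul_prod_erase Finset.univ c (Finset.mem_univ j)]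
            ring
          · intro b _ hb
            rw [Pi.smul_apply, hx b j hb.symm, smul_zero]
          · simp
        rw [this]
        exact Submodule.sum_mem _ fun i _ => Submodule.smul_mem _ _ ⟨Additive.ofMul (x i), rfl⟩
    · rw [rank_fun', Nat.card_eq_fintype_card]
  have h2 := LinearMap.lift_rank_range_add_rank_ker f.toAdditive.toIntLinearMap
  have h3 : Module.rank ℤ (LinearMap.ker f.toAdditive.toIntLinearMap) = zRank f.ker :=
    LinearEquiv.rank_eq (AddEquiv.toIntLinearEquiv
      { toFun := fun x => Additive.ofMul ⟨x.1.toMul, x.2⟩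
        invFun := fun x => ⟨Additive.ofMul x.toMul.1, x.toMul.2⟩
        map_add' := fun _ _ => rfl
        left_inv := fun _ => rfl
        right_inv := fun _ => rfl })
  rw [h1, h3, Cardinal.lift_natCast, ← Cardinal.lift_natCast.{v, u}, ← Cardinal.lift_add] at h2
  exact (Cardinal.lift_injective h2).symm.trans (add_comm _ _)

/-! ### The eigenvector algebra as a multiplier ring -/

section
variable {F : Type*} [Field F] [NumberField F] {n : ℕ}

theorem algebraMap_zInv_eq {N : ℕ} (r : ZInv N) : algebraMap (ZInv N) F r = algebraMap ℚ F r := rfl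

theorem inv_mem_zInv (N : ℕ) : (N : ℚ)⁻¹ ∈ ZInv N := Algebra.subset_adjoin rfl

theorem isNoetherianRing_zInv (N : ℕ) : IsNoetherianRing (ZInv N) :=
  have : Algebra.FiniteType ℤ (ZInv N) :=
    (Subalgebra.fg_iff_finiteType _).mp ⟨{(N : ℚ)⁻¹}, by rw [Finset.coe_singleton]⟩
  Algebra.FiniteType.isNoetherianRing ℤ (ZInv N)

theorem exists_pow_mul_eq_intCast {N : ℕ} (hN : N ≠ 0) {q : ℚ} (hq : q ∈ ZInv N) :
    ∃ (j : ℕ) (a : ℤ), (N : ℚ) ^ j * q = a := by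
  have hN' : (N : ℚ) ≠ 0 := by exact_mod_cast hN
  induction hq using Algebra.adjoin_induction with
  | mem x hx =>
    obtain rfl : x = (N : ℚ)⁻¹ := hx
    exact ⟨1, 1, by simp [hN']⟩
  | algebraMap r => exact ⟨0, r, by simp⟩
  | add x y _ _ hx hy =>
    obtain ⟨j, a, ha⟩ := hx
    obtain ⟨k, b, hb⟩ := hy
    refine ⟨j + k, N ^ k * a + N ^ j * b, ?_⟩
    push_cast
    rw [← ha, ← hb]
    ring
  | mul x y _ _ hx hy =>
    obtain ⟨j, a, ha⟩ := hx
    obtain ⟨k, b, hb⟩ := hy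
    refine ⟨j + k, a * b, ?_⟩
    push_cast
    rw [← ha, ← hb]
    ring

/-- `ℤ[1/N]` is the localization of `ℤ` away from `N`. -/
theorem isLocalization_zInv {N : ℕ} (hN : N ≠ 0) : IsLocalization.Away (N : ℤ) (ZInv N) := by
  have hN' : (N : ℚ) ≠ 0 := by exact_mod_cast hN
  refine ⟨⟨?_, ?_, ?_⟩⟩
  · rintro ⟨_, j, rfl⟩
    rw [map_pow]
    refine (IsUnit.of_mul_eq_one (⟨_, inv_mem_zInv N⟩ : ZInv N) (Subtype.ext ?_)).pow j
    simp [hN']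
  · rintro ⟨q, hq⟩
    obtain ⟨j, a, ha⟩ := exists_pow_mul_eq_intCast hN hq
    refine ⟨(a, ⟨_, j, rfl⟩), Subtype.ext ?_⟩
    simp [← ha, mul_comm]
  · intro x y h
    refine ⟨1, ?_⟩
    have := congrArg (fun r : ZInv N => (r : ℚ)) h
    simpa using this

/-- Row `i` of `A` lists the coordinates of `c * w i`, which `Algebra.leftMulMatrix` stores in
column `i`; hence the transpose. -/
theorem actsBy_iff_toMatrix {N : ℕ} {w : Module.Basis (Fin n) ℚ F}
    {A : Matrix (Fin n) (Fin n) (ZInv N)} {c : F} :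
    ActsBy N w A c ↔ A.map (algebraMap (ZInv N) ℚ) = (Algebra.leftMulMatrix w c).transpose := by
  have h1 : ActsBy N w A c ↔ ∀ i, ∑ j, (A i j : ℚ) • w j = c * w i := by
    simp only [ActsBy, funext_iff, Matrix.mulVec, dotProduct, Matrix.map_apply, Pi.smul_apply,
      smul_eq_mul, Algebra.smul_def (A := F), algebraMap_zInv_eq]
  rw [h1, ← Matrix.ext_iff]
  refine forall_congr' fun i => ?_
  rw [← w.repr.injective.eq_iff, Finsupp.ext_iff]
  refine forall_congr' fun j => ?_
  simp only [Matrix.map_apply, Matrix.transpose_apply, Algebra.leftMulMatrix_eq_repr_mul]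
  rw [map_sum, Finsupp.finsetSum_apply]
  simp [Finsupp.single_apply]

theorem actsBy_iff_phi {N : ℕ} {w : Module.Basis (Fin n) ℚ F} (A : eigenAlgebra N w) (c : F) :
    ActsBy N w A.1 c ↔ c = phi N w A :=
  ⟨fun h => h.unique (phi_spec N w A), fun h => h ▸ phi_spec N w A⟩

/-- `φ` as an algebra homomorphism. -/
noncomputable def phiHom (N : ℕ) (w : Module.Basis (Fin n) ℚ F) :
    eigenAlgebra N w →ₐ[ZInv N] F where
  toFun := phi N w
  map_one' := ((actsBy_iff_phi (1 : eigenAlgebra N w) 1).mp actsBy_one).symm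
  map_mul' A B :=
    ((actsBy_iff_phi (A * B) _).mp ((phi_spec N w A).mul (phi_spec N w B))).symm
  map_zero' := ((actsBy_iff_phi (0 : eigenAlgebra N w) 0).mp (by
    simpa using actsBy_algebraMap (w := w) (0 : ZInv N))).symm
  map_add' A B :=
    ((actsBy_iff_phi (A + B) _).mp ((phi_spec N w A).add (phi_spec N w B))).symm
  commutes' r := ((actsBy_iff_phi (algebraMap _ (eigenAlgebra N w) r) _).mp
    (actsBy_algebraMap r)).symm

theorem phi_injective (N : ℕ) (w : Module.Basis (Fin n) ℚ F) : Function.Injective (phi N w) := by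
  intro A B h
  have := phi_spec N w B
  rw [← h] at this
  exact Subtype.ext ((phi_spec N w A).ext this)

theorem order_eq_range (N : ℕ) (w : Module.Basis (Fin n) ℚ F) :
    order N w = (phiHom N w).range :=
  SetLike.coe_injective (by rw [AlgHom.coe_range]; rfl)

/-- `φ` as an isomorphism onto the order. -/
noncomputable def phiEquiv (N : ℕ) (w : Module.Basis (Fin n) ℚ F) :
    eigenAlgebra N w ≃ₐ[ZInv N] order N w :=
  (AlgEquiv.ofInjective (phiHom N w) (phi_injective N w)).trans
    (Subalgebra.equivOfEq _ _ (order_eq_range N w).symm)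

theorem coe_phiEquiv (N : ℕ) (w : Module.Basis (Fin n) ℚ F) (A : eigenAlgebra N w) :
    (phiEquiv N w A : F) = phi N w A := rfl

theorem mem_order_iff_actsBy {N : ℕ} {w : Module.Basis (Fin n) ℚ F} {x : F} :
    x ∈ order N w ↔ ∃ A, ActsBy N w A x :=
  ⟨fun ⟨A, hA⟩ => ⟨A.1, hA ▸ phi_spec N w A⟩,
    fun ⟨A, hA⟩ => ⟨⟨A, x, hA⟩, ((actsBy_iff_phi ⟨A, x, hA⟩ x).mp hA).symm⟩⟩

theorem mem_order_iff_leftMulMatrix {N : ℕ} {w : Module.Basis (Fin n) ℚ F} {x : F} :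
    x ∈ order N w ↔ ∀ i j, Algebra.leftMulMatrix w x i j ∈ ZInv N := by
  rw [mem_order_iff_actsBy]
  constructor
  · rintro ⟨A, hA⟩ i j
    rw [actsBy_iff_toMatrix] at hA
    rw [← Matrix.transpose_apply (Algebra.leftMulMatrix w x), ← hA]
    exact (A j i).2
  · intro h
    exact ⟨Matrix.of fun i j => ⟨_, h j i⟩, actsBy_iff_toMatrix.mpr rfl⟩

theorem norm_phi {N : ℕ} {w : Module.Basis (Fin n) ℚ F} (A : eigenAlgebra N w) :
    Algebra.norm ℚ (phi N w A) = ((A.1.det : ZInv N) : ℚ) := by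
  rw [Algebra.norm_eq_matrix_det w, ← Matrix.det_transpose,
    ← actsBy_iff_toMatrix.mp (phi_spec N w A)]
  exact ((algebraMap (ZInv N) ℚ).map_det A.1).symm

theorem exists_int_smul_mem_order (N : ℕ) (w : Module.Basis (Fin n) ℚ F) (x : F) :
    ∃ d : ℕ, d ≠ 0 ∧ (d : F) * x ∈ order N w := by
  let q := Algebra.leftMulMatrix w x
  refine ⟨∏ i, ∏ j, (q i j).den, ?_, ?_⟩
  · simp [Finset.prod_ne_zero_iff]
  rw [mem_order_iff_leftMulMatrix]
  intro i j
  have h1 : (q i j).den ∣ ∏ i, ∏ j, (q i j).den :=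
    (Finset.dvd_prod_of_mem (fun j => (q i j).den) (Finset.mem_univ j)).trans
      (Finset.dvd_prod_of_mem (fun i => ∏ j, (q i j).den) (Finset.mem_univ i))
  obtain ⟨k, hk⟩ := h1
  rw [hk, ← nsmul_eq_mul, map_nsmul, Matrix.smul_apply, mul_comm, mul_smul]
  refine nsmul_mem ?_ k
  have : (q i j).den • q i j = ((q i j).num : ℚ) := by
    rw [nsmul_eq_mul, Rat.den_mul_eq_num]
  change (q i j).den • q i j ∈ _
  rw [this]
  exact intCast_mem _ _

theorem isOrder_order (N : ℕ) (w : Module.Basis (Fin n) ℚ F) : IsOrder (order N w) where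
  finite := by
    have := isNoetherianRing_zInv N
    -- A submodule of the finite free module of matrices over a Noetherian ring.
    have : Module.Finite (ZInv N) (eigenAlgebra N w) :=
      Module.Finite.of_injective (eigenAlgebra N w).val.toLinearMap Subtype.val_injective
    exact Module.Finite.equiv (phiEquiv N w).toLinearEquiv
  span_eq_top := by
    rw [eq_top_iff]
    intro x _
    obtain ⟨d, hd, h⟩ := exists_int_smul_mem_order N w x
    have : x = (d : ℚ)⁻¹ • ((d : F) * x) := by
      rw [Algebra.smul_def, ← mul_assoc]
      simp [hd]
    rw [this]
    exact Submodule.smul_mem _ _ (Submodule.subset_span h)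

theorem mem_lattice_iff {N : ℕ} {w : Module.Basis (Fin n) ℚ F} {y : F} :
    y ∈ lattice N w ↔ ∀ i, w.repr y i ∈ ZInv N := by
  constructor
  · intro h
    induction h using Submodule.span_induction with
    | mem x hx =>
      obtain ⟨j, rfl⟩ := hx
      intro i
      rw [w.repr_self, Finsupp.single_apply]
      split_ifs
      exacts [one_mem _, zero_mem _]
    | zero => simp
    | add x y _ _ hx hy => intro i; rw [map_add]; exact add_mem (hx i) (hy i)
    | smul a x _ hx =>
      intro i
      have : w.repr (a • x) = (a : ℚ) • w.repr x := w.repr.map_smul (a : ℚ) x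
      rw [this]
      exact mul_mem a.2 (hx i)
  · intro h
    rw [← w.sum_repr y]
    exact Submodule.sum_mem _ fun i _ =>
      Submodule.smul_mem (lattice N w) (⟨_, h i⟩ : ZInv N) (Submodule.subset_span ⟨i, rfl⟩)

/-- Column `j` of the multiplication matrix holds the coordinates of `x * w j`, and by linearity
stability of the lattice need only be tested on the `w j`. -/
theorem coe_order_eq_multiplier (N : ℕ) (w : Module.Basis (Fin n) ℚ F) :
    (order N w : Set F) = {x : F | ∀ y ∈ lattice N w, x * y ∈ lattice N w} := by
  ext x
  rw [SetLike.mem_coe, mem_order_iff_leftMulMatrix, Set.mem_ofPred_eq]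
  have key : (∀ i j, Algebra.leftMulMatrix w x i j ∈ ZInv N) ↔ ∀ j, x * w j ∈ lattice N w := by
    simp only [Algebra.leftMulMatrix_eq_repr_mul, mem_lattice_iff]
    exact forall_comm
  rw [key]
  refine ⟨fun h y hy => ?_, fun h j => h _ (Submodule.subset_span ⟨j, rfl⟩)⟩
  induction hy using Submodule.span_induction with
  | mem y hy => obtain ⟨j, rfl⟩ := hy; exact h j
  | zero => simp
  | add y z _ _ hy hz => rw [mul_add]; exact add_mem hy hz
  | smul a y _ hy => rw [mul_smul_comm]; exact Submodule.smul_mem _ _ hy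

theorem toHomUnits_injective (N : ℕ) (w : Module.Basis (Fin n) ℚ F) :
    Function.Injective (eigenGroup.toAlgebra N w).toHomUnits := by
  intro A B h
  have h1 := congrArg (fun u : (eigenAlgebra N w)ˣ => (u : eigenAlgebra N w).1) h
  exact Subtype.ext (Subtype.ext h1)

theorem range_toHomUnits (N : ℕ) (w : Module.Basis (Fin n) ℚ F) :
    (eigenGroup.toAlgebra N w).toHomUnits.range = (detUnits N w).ker := by
  ext u
  rw [MonoidHom.mem_ker]
  constructor
  · rintro ⟨A, rfl⟩
    exact Units.ext A.1.2
  · intro h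
    exact ⟨⟨⟨u.1.1, congrArg Units.val h⟩, u.1.2⟩, Units.ext rfl⟩

theorem mem_normOneUnits_iff {N : ℕ} {O : Subalgebra (ZInv N) F} {x : Oˣ} :
    x ∈ normOneUnits O ↔ Algebra.norm ℚ ((x : O) : F) = 1 := Iff.rfl

theorem map_phiEquiv_ker_detUnits (N : ℕ) (w : Module.Basis (Fin n) ℚ F) :
    (detUnits N w).ker.map (Units.mapEquiv (phiEquiv N w).toMulEquiv).toMonoidHom =
      normOneUnits (order N w) := by
  ext x
  rw [Subgroup.mem_map_equiv, mem_normOneUnits_iff, MonoidHom.mem_ker]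
  set y := (Units.mapEquiv (phiEquiv N w).toMulEquiv).symm x with hy
  have : ((x : order N w) : F) = phi N w y := by
    rw [← coe_phiEquiv]
    exact congrArg (fun z : (order N w)ˣ => ((z : order N w) : F))
      ((Units.mapEquiv (phiEquiv N w).toMulEquiv).apply_symm_apply x).symm
  rw [this, norm_phi, Units.ext_iff]
  exact Subtype.ext_iff

/-- `φ` induces an isomorphism `Γ ≃ 𝓞¹`. -/
noncomputable def eigenGroupEquiv (N : ℕ) (w : Module.Basis (Fin n) ℚ F) :
    eigenGroup N w ≃* normOneUnits (order N w) :=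
  (MonoidHom.ofInjective (toHomUnits_injective N w)).trans <|
    (MulEquiv.subgroupCongr (range_toHomUnits N w)).trans <|
    ((Units.mapEquiv (phiEquiv N w).toMulEquiv).subgroupMap _).trans
      (MulEquiv.subgroupCongr (map_phiEquiv_ker_detUnits N w))

theorem coe_eigenGroupEquiv (N : ℕ) (w : Module.Basis (Fin n) ℚ F) (A : eigenGroup N w) :
    (((eigenGroupEquiv N w A : (order N w)ˣ) : order N w) : F) =
      phi N w (eigenGroup.toAlgebra N w A) := rfl

end
-- Powers of `S`-units lie in every order
section
open NumberField IsDedekindDomain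
variable {F : Type*} [Field F] [NumberField F]

/-- Divide by the gcd with `N` until it is `1`. This isolates the part of a conductor that is
invertible in `ℤ[1/N]`. -/
theorem exists_eq_mul_coprime {m : ℕ} (hm : m ≠ 0) (N : ℕ) :
    ∃ t c j : ℕ, m = t * c ∧ t ∣ N ^ j ∧ c.Coprime N := by
  induction m using Nat.strong_induction_on with
  | _ m ih =>
    by_cases h : m.Coprime N
    · exact ⟨1, m, 0, by simp, by simp, h⟩
    · obtain ⟨l, hl⟩ := Nat.gcd_dvd_left m N
      have hl0 : l ≠ 0 := by rintro rfl; exact hm (by simpa using hl)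
      have hg : 1 < m.gcd N := by
        have := Nat.gcd_pos_of_pos_left N (Nat.pos_of_ne_zero hm)
        have : m.gcd N ≠ 1 := h
        omega
      have hlt : l < m := by
        conv_rhs => rw [hl]
        exact lt_mul_of_one_lt_left (Nat.pos_of_ne_zero hl0) hg
      obtain ⟨t, c, j, h1, h2, h3⟩ := ih l hlt hl0
      refine ⟨m.gcd N * t, c, j + 1, ?_, ?_, h3⟩
      · conv_lhs => rw [hl, h1]
        ring
      · rw [pow_succ']
        exact mul_dvd_mul (Nat.gcd_dvd_right m N) h2

variable {N : ℕ} {O : Subalgebra (ZInv N) F}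

theorem inv_mem_subalgebra (O : Subalgebra (ZInv N) F) : (N : F)⁻¹ ∈ O := by
  have := O.algebraMap_mem ⟨_, inv_mem_zInv N⟩
  rwa [algebraMap_zInv_eq, map_inv₀, map_natCast] at this

theorem inv_mem_subalgebra_of_dvd_pow (hN : N ≠ 0) (O : Subalgebra (ZInv N) F) {t j : ℕ}
    (h : t ∣ N ^ j) : (t : F)⁻¹ ∈ O := by
  obtain ⟨s, hs⟩ := h
  have hN' : (N : F) ≠ 0 := by exact_mod_cast hN
  have h1 : (N : F) ^ j = t * s := by exact_mod_cast hs
  have ht : (t : F) ≠ 0 := by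
    rintro h0
    rw [h0, zero_mul] at h1
    exact pow_ne_zero j hN' h1
  have : (t : F)⁻¹ = s * (N : F)⁻¹ ^ j := by
    have hs0 : (s : F) ≠ 0 := by
      rintro h0
      rw [h0, mul_zero] at h1
      exact pow_ne_zero j hN' h1
    rw [inv_pow, h1]
    field_simp
  rw [this]
  exact mul_mem (natCast_mem O s) (pow_mem (inv_mem_subalgebra O) j)

namespace IsOrder

theorem exists_mul_mem (hO : IsOrder O) (x : F) : ∃ d : ℕ, d ≠ 0 ∧ (d : F) * x ∈ O := by
  have hx : x ∈ Submodule.span ℚ (O : Set F) := by rw [hO.span_eq_top]; trivial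
  induction hx using Submodule.span_induction with
  | mem x hx => exact ⟨1, one_ne_zero, by simpa using hx⟩
  | zero => exact ⟨1, one_ne_zero, by simp⟩
  | add x y _ _ hx hy =>
    obtain ⟨d, hd, hx⟩ := hx
    obtain ⟨e, he, hy⟩ := hy
    refine ⟨d * e, mul_ne_zero hd he, ?_⟩
    have : ((d * e : ℕ) : F) * (x + y) = e * (d * x) + d * (e * y) := by push_cast; ring
    rw [this]
    exact add_mem (mul_mem (natCast_mem O e) hx) (mul_mem (natCast_mem O d) hy)
  | smul q x _ hx =>
    obtain ⟨d, hd, hx⟩ := hx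
    refine ⟨q.den * d, mul_ne_zero q.den_ne_zero hd, ?_⟩
    have h1 : ((q.den * d : ℕ) : F) * (q • x) = (q.num : F) * (d * x) := by
      have : (q.den : F) * algebraMap ℚ F q = q.num := by
        rw [← map_natCast (algebraMap ℚ F), ← map_mul, Rat.den_mul_eq_num, map_intCast]
      rw [Algebra.smul_def, ← this]
      push_cast
      ring
    rw [h1]
    exact mul_mem (intCast_mem O _) hx

/-- An order contains a multiple of the ring of integers by an integer prime to `N`. -/
theorem exists_coprime_conductor (hO : IsOrder O) (hN : N ≠ 0) :
    ∃ c : ℕ, c ≠ 0 ∧ c.Coprime N ∧ ∀ x : 𝓞 F, (c : F) * x ∈ O := by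
  -- `𝓞 F` is finitely generated over `ℤ`, so one integer serves all its elements.
  obtain ⟨s, hs⟩ := Module.Finite.fg_top (R := ℤ) (M := 𝓞 F)
  choose d hd hdO using fun x : 𝓞 F => hO.exists_mul_mem (x : F)
  have hm : ∏ x ∈ s, d x ≠ 0 := Finset.prod_ne_zero_iff.mpr fun x _ => hd x
  have hmO : ∀ x : 𝓞 F, ((∏ x ∈ s, d x : ℕ) : F) * x ∈ O := by
    intro x
    have hx : x ∈ Submodule.span ℤ (s : Set (𝓞 F)) := by rw [hs]; trivial
    induction hx using Submodule.span_induction with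
    | mem x hx =>
      obtain ⟨k, hk⟩ := Finset.dvd_prod_of_mem d hx
      rw [hk, Nat.cast_mul, mul_comm (d x : F), mul_assoc]
      exact mul_mem (natCast_mem O k) (hdO x)
    | zero => simp
    | add x y _ _ hx hy =>
      change _ * ((x : F) + y) ∈ O
      rw [mul_add]
      exact add_mem hx hy
    | smul a x _ hx =>
      have : ((a • x : 𝓞 F) : F) = a • (x : F) := map_zsmul (algebraMap (𝓞 F) F) a x
      rw [this, mul_smul_comm]
      exact zsmul_mem hx a
  obtain ⟨t, c, j, htc, ht, hc⟩ := exists_eq_mul_coprime hm N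
  refine ⟨c, right_ne_zero_of_mul (htc ▸ hm), hc, fun x => ?_⟩
  have ht0 : (t : F) ≠ 0 := by
    norm_cast
    rintro rfl
    simp [htc] at hm
  have := mul_mem (inv_mem_subalgebra_of_dvd_pow hN O ht) (hmO x)
  rwa [htc, Nat.cast_mul, mul_assoc, inv_mul_cancel_left₀ ht0] at this

/-- With `c` the conductor prime to `N`, `a` is a unit in the finite ring `𝓞 F / c`. Hence `a ^ k ∈
1 + c • 𝓞 F ⊆ O` for some `k ≠ 0`. -/
theorem exists_pow_mem_of_dvd (hO : IsOrder O) (hN : N ≠ 0) {a : 𝓞 F} {i : ℕ}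
    (ha : a ∣ (N : 𝓞 F) ^ i) : ∃ k : ℕ, k ≠ 0 ∧ (a : F) ^ k ∈ O := by
  obtain ⟨c, hc0, hc, hcO⟩ := hO.exists_coprime_conductor hN
  have hI : Ideal.span {(c : 𝓞 F)} ≠ ⊥ := by
    rw [Ne, Ideal.span_singleton_eq_bot]
    exact_mod_cast hc0
  have : Finite (𝓞 F ⧸ Ideal.span {(c : 𝓞 F)}) := Ideal.finiteQuotientOfFreeOfNeBot _ hI
  have hu : IsUnit (Ideal.Quotient.mk (Ideal.span {(c : 𝓞 F)}) a) := by
    have h1 : IsUnit (Ideal.Quotient.mk (Ideal.span {(c : 𝓞 F)}) (N : 𝓞 F)) := by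
      have h2 : IsCoprime (c : ℤ) (N : ℤ) := Nat.isCoprime_iff_coprime.mpr hc
      obtain ⟨x, y, hxy⟩ := h2
      refine IsUnit.of_mul_eq_one (Ideal.Quotient.mk _ (y : 𝓞 F)) ?_
      rw [← map_mul, ← map_one (Ideal.Quotient.mk _), Ideal.Quotient.eq,
        Ideal.mem_span_singleton]
      refine ⟨-x, ?_⟩
      have h3 : (x : 𝓞 F) * c + y * N = 1 := by exact_mod_cast congrArg (Int.cast : ℤ → 𝓞 F) hxy
      linear_combination h3
    exact isUnit_of_dvd_unit (map_dvd _ ha) (by rw [map_pow]; exact h1.pow i)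
  obtain ⟨u, hu⟩ := hu
  obtain ⟨k, hk, hk1⟩ := (isOfFinOrder_of_finite u).exists_pow_eq_one
  refine ⟨k, hk.ne', ?_⟩
  have h2 : Ideal.Quotient.mk (Ideal.span {(c : 𝓞 F)}) (a ^ k) = Ideal.Quotient.mk _ 1 := by
    rw [map_pow, ← hu, ← Units.val_pow_eq_pow_val, hk1, Units.val_one, map_one]
  rw [Ideal.Quotient.eq, Ideal.mem_span_singleton] at h2
  obtain ⟨y, hy⟩ := h2
  have h3 : (a : F) ^ k = 1 + c * (y : F) := by
    have := congrArg (algebraMap (𝓞 F) F) (eq_add_of_sub_eq' hy)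
    simpa using this
  rw [h3]
  exact add_mem (one_mem O) (hcO y)

/-- The hypotheses express that `u` is a unit of `𝓞 F` with `N` inverted. Then `a * b` is a power of
`N`, and the powers of `N` separating `u` from `a` are invertible in `O`. -/
theorem exists_pow_mem (hO : IsOrder O) (hN : N ≠ 0) {u : Fˣ} {a b : 𝓞 F} {i j : ℕ}
    (ha : (N : F) ^ i * u = a) (hb : (N : F) ^ j * (u⁻¹ : Fˣ) = b) :
    ∃ k : ℕ, k ≠ 0 ∧ (u : F) ^ k ∈ O := by
  have hN' : (N : F) ≠ 0 := by exact_mod_cast hN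
  have hab : a ∣ (N : 𝓞 F) ^ (i + j) := by
    refine ⟨b, RingOfIntegers.ext ?_⟩
    change algebraMap (𝓞 F) F (N ^ (i + j)) = (a : F) * (b : F)
    rw [← ha, ← hb, map_pow, map_natCast]
    rw [mul_mul_mul_comm, Units.mul_inv, mul_one, pow_add]
  obtain ⟨k, hk, h⟩ := hO.exists_pow_mem_of_dvd hN hab
  refine ⟨k, hk, ?_⟩
  have : (u : F) ^ k = (N : F)⁻¹ ^ (i * k) * (a : F) ^ k := by
    rw [← ha, mul_pow, inv_pow, pow_mul, inv_mul_cancel_left₀]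
    exact pow_ne_zero _ (pow_ne_zero _ hN')
  rw [this]
  exact mul_mem (pow_mem (inv_mem_subalgebra O) _) h

/-- A power of every `S`-unit is a unit of the order. -/
theorem exists_unit_eq_pow (hO : IsOrder O) (hN : N ≠ 0) {u : Fˣ} {a b : 𝓞 F} {i j : ℕ}
    (ha : (N : F) ^ i * u = a) (hb : (N : F) ^ j * (u⁻¹ : Fˣ) = b) :
    ∃ k : ℕ, k ≠ 0 ∧ ∃ y : Oˣ, Units.map (O.val : O →* F) y = u ^ k := by
  obtain ⟨k, hk, h⟩ := hO.exists_pow_mem hN ha hb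
  obtain ⟨l, hl, h'⟩ := hO.exists_pow_mem hN hb (by rwa [inv_inv])
  -- The exponents found for `u` and `u⁻¹` may differ; their product works for both.
  refine ⟨k * l, mul_ne_zero hk hl, ⟨⟨_, pow_mem h l⟩, ⟨_, pow_mem h' k⟩, ?_, ?_⟩, ?_⟩
  · apply Subtype.ext
    simp only [MulMemClass.mk_mul_mk, OneMemClass.coe_one, ← pow_mul, mul_comm l k, ← mul_pow,
      Units.mul_inv, one_pow]
  · apply Subtype.ext
    simp only [MulMemClass.mk_mul_mk, OneMemClass.coe_one, ← pow_mul, mul_comm l k, ← mul_pow,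
      Units.inv_mul, one_pow]
  · ext
    simp [pow_mul]

/-- Elements of `O` are integral over `ℤ[1/N]`, a localization of `ℤ`, so a power of `N` clears the
denominators of an integral equation. -/
theorem exists_pow_mul_integral (hO : IsOrder O) (hN : N ≠ 0) {x : F} (hx : x ∈ O) :
    ∃ (i : ℕ) (a : 𝓞 F), (N : F) ^ i * x = a := by
  have := hO.finite
  have := isLocalization_zInv hN
  have h1 : IsIntegral (ZInv N) x :=
    (Algebra.IsIntegral.isIntegral (R := ZInv N) (⟨x, hx⟩ : O)).map O.val
  obtain ⟨⟨_, i, rfl⟩, h2⟩ :=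
    IsIntegral.exists_multiple_integral_of_isLocalization (Submonoid.powers (N : ℤ)) x h1
  refine ⟨i, ⟨(N : F) ^ i * x, ?_⟩, rfl⟩
  have : (N : F) ^ i * x = ((N : ℤ) ^ i) • x := by simp
  rw [this]
  exact h2

end IsOrder

end
-- Valuations above `N` and the rank of the unit group
section
open NumberField IsDedekindDomain
variable {F : Type*} [Field F] [NumberField F]

/-- The primes of `F` dividing `N`. -/
abbrev PrimesAbove (F : Type*) [Field F] [NumberField F] (N : ℕ) : Type _ :=
  {v : HeightOneSpectrum (𝓞 F) // (N : 𝓞 F) ∈ v.asIdeal}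

theorem finite_primesAbove {N : ℕ} (hN : N ≠ 0) : Finite (PrimesAbove F N) := by
  have h : (Ideal.span {(N : 𝓞 F)}) ≠ 0 := by
    rw [Ne, Submodule.zero_eq_bot, Ideal.span_singleton_eq_bot]
    exact_mod_cast hN
  have := (Ideal.finite_factors h).to_subtype
  exact Finite.of_injective
    (β := {v : HeightOneSpectrum (𝓞 F) | v.asIdeal ∣ Ideal.span {(N : 𝓞 F)}})
    (fun v => ⟨v.1, Ideal.dvd_span_singleton.mpr v.2⟩)
    fun v w h => Subtype.ext (by simpa using h)

theorem valuationOfNeZero_eq_one_iff {v : HeightOneSpectrum (𝓞 F)} {u : Fˣ} :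
    v.valuationOfNeZero u = 1 ↔ v.valuation F (u : F) = 1 := by
  rw [← v.valuationOfNeZero_eq, ← WithZero.coe_one, WithZero.coe_inj]

/-- For `h` the class number, `v ^ h` is principal; `a` is a generator. -/
theorem exists_mem_iff_eq (v : HeightOneSpectrum (𝓞 F)) :
    ∃ (a : 𝓞 F) (h : ℕ), a ≠ 0 ∧ (∀ w : HeightOneSpectrum (𝓞 F), a ∈ w.asIdeal ↔ w = v) ∧
      ∀ x ∈ v.asIdeal, a ∣ x ^ h := by
  have hv0 : v.asIdeal ∈ nonZeroDivisors (Ideal (𝓞 F)) := mem_nonZeroDivisors_of_ne_zero v.ne_bot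
  set h := Fintype.card (ClassGroup (𝓞 F)) with hh
  have hpos : h ≠ 0 := Fintype.card_ne_zero
  have h1 : ClassGroup.mk0 ((⟨v.asIdeal, hv0⟩ : nonZeroDivisors (Ideal (𝓞 F))) ^ h) = 1 := by
    rw [map_pow, pow_card_eq_one]
  rw [ClassGroup.mk0_eq_one_iff] at h1
  obtain ⟨a, ha⟩ := h1.principal
  have ha' : v.asIdeal ^ h = Ideal.span {a} := by simpa using ha
  have ha0 : a ≠ 0 := by
    rintro rfl
    rw [Ideal.span_singleton_eq_bot.mpr rfl] at ha'
    exact pow_ne_zero h v.ne_bot ha'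
  refine ⟨a, h, ha0, fun w => ?_, fun x hx => ?_⟩
  · rw [← Ideal.span_singleton_le_iff_mem, ← ha', w.isPrime.pow_le_iff hpos]
    constructor
    · intro hle
      exact HeightOneSpectrum.ext (v.isMaximal.eq_of_le w.isPrime.ne_top hle).symm
    · rintro rfl
      exact le_rfl
  · rw [← Ideal.mem_span_singleton, ← ha']
    exact Ideal.pow_mem_pow hx h

variable {N : ℕ} {O : Subalgebra (ZInv N) F}

/-- The inclusion `Oˣ → Fˣ`. -/
def unitsToField (O : Subalgebra (ZInv N) F) : Oˣ →* Fˣ := Units.map (O.val : O →* F)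

theorem unitsToField_injective (O : Subalgebra (ZInv N) F) :
    Function.Injective (unitsToField O) :=
  Units.map_injective Subtype.val_injective

/-- The valuations of the units of `O` at the primes dividing `N`. -/
noncomputable def unitsValuation (O : Subalgebra (ZInv N) F) :
    Oˣ →* Multiplicative (PrimesAbove F N → ℤ) where
  toFun y := Multiplicative.ofAdd fun v => (v.1.valuationOfNeZero (unitsToField O y)).toAdd
  map_one' := by simp; rfl
  map_mul' x y := by simp; rfl

theorem unitsValuation_apply_eq_zero_iff {y : Oˣ} {v : PrimesAbove F N} :
    (unitsValuation O y).toAdd v = 0 ↔ v.1.valuation F ((y : O) : F) = 1 := by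
  refine Iff.trans ?_ (valuationOfNeZero_eq_one_iff (u := unitsToField O y))
  exact toAdd_eq_zero

theorem mem_ker_unitsValuation_iff {y : Oˣ} :
    y ∈ (unitsValuation O).ker ↔
      ∀ v : PrimesAbove F N, v.1.valuation F ((y : O) : F) = 1 := by
  simp_rw [← unitsValuation_apply_eq_zero_iff]
  rw [MonoidHom.mem_ker]
  exact ⟨fun h v => congrFun h v, fun h => funext h⟩

namespace IsOrder

/-- A generator `a` of a power of `v` divides a power of `N`, so a power of `a` is a unit of `O`;
its only nontrivial valuation is at `v`. -/
theorem exists_unitsValuation_eq_single (hO : IsOrder O) (hN : N ≠ 0) (v : PrimesAbove F N) :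
    ∃ y : Oˣ, (unitsValuation O y).toAdd v ≠ 0 ∧
      ∀ w ≠ v, (unitsValuation O y).toAdd w = 0 := by
  obtain ⟨a, h, ha0, hav, hdvd⟩ := exists_mem_iff_eq v.1
  obtain ⟨b, hb⟩ := hdvd _ v.2
  have ha0' : (a : F) ≠ 0 := by simpa using ha0
  have hb' : (N : F) ^ h * ((Units.mk0 (a : F) ha0')⁻¹ : Fˣ) = b := by
    have : (N : F) ^ h = a * b := by
      have := congrArg (algebraMap (𝓞 F) F) hb
      rwa [map_pow, map_natCast, map_mul] at this
    rw [this, mul_comm (a : F), mul_assoc, Units.val_inv_eq_inv_val, Units.val_mk0,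
      mul_inv_cancel₀ ha0', mul_one]
  obtain ⟨k, hk, y, hy⟩ := hO.exists_unit_eq_pow hN (i := 0) (u := Units.mk0 (a : F) ha0')
    (by rw [pow_zero, one_mul, Units.val_mk0]) hb'
  have hy' : ((y : O) : F) = (a : F) ^ k := by simpa using congrArg Units.val hy
  have key (w : PrimesAbove F N) : (unitsValuation O y).toAdd w = 0 ↔ w ≠ v := by
    rw [unitsValuation_apply_eq_zero_iff, hy', map_pow, pow_eq_one_iff, or_iff_left hk,
      HeightOneSpectrum.valuation_eq_one_iff_notMem, hav, Ne, Subtype.ext_iff]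
  exact ⟨y, by simp [key], fun w hw => (key w).mpr hw⟩

/-- Away from `N` an element of `O` has no poles, being integral up to a power of `N`; above `N`
membership in the kernel excludes them. -/
theorem mem_range_of_mem_ker (hO : IsOrder O) (hN : N ≠ 0) {y : Oˣ}
    (hy : y ∈ (unitsValuation O).ker) : ∃ a : 𝓞 F, (a : F) = (y : O) := by
  obtain ⟨i, a, ha⟩ := hO.exists_pow_mul_integral hN (y : O).2
  refine HeightOneSpectrum.mem_integers_of_valuation_le_one F _ fun v => ?_
  by_cases hv : (N : 𝓞 F) ∈ v.asIdeal
  · exact (mem_ker_unitsValuation_iff.mp hy ⟨v, hv⟩).le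
  · have h1 : v.valuation F (N : F) = 1 := by
      have := (HeightOneSpectrum.valuation_eq_one_iff_notMem (K := F) v).mpr hv
      rwa [map_natCast] at this
    have h2 := v.valuation_le_one (K := F) a
    change v.valuation F (a : F) ≤ 1 at h2
    rwa [← ha, map_mul, map_pow, h1, one_pow, one_mul] at h2

theorem zRank_ker_unitsValuation (hO : IsOrder O) (hN : N ≠ 0) :
    zRank (unitsValuation O).ker = (Fintype.card (InfinitePlace F) - 1 : ℕ) := by
  have hR : zRank (𝓞 F)ˣ = (Fintype.card (InfinitePlace F) - 1 : ℕ) := by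
    rw [zRank, ← Module.finrank_eq_rank, Units.finrank_eq]
    rfl
  let g : (𝓞 F)ˣ →* Fˣ := Units.map (algebraMap (𝓞 F) F : 𝓞 F →* F)
  have hg : Function.Injective g := Units.map_injective RingOfIntegers.coe_injective
  let f : (unitsValuation O).ker →* g.range :=
    ((unitsToField O).comp (unitsValuation O).ker.subtype).codRestrict g.range (by
      rintro ⟨y, hy⟩
      obtain ⟨a, ha⟩ := hO.mem_range_of_mem_ker hN hy
      obtain ⟨b, hb⟩ := hO.mem_range_of_mem_ker hN (inv_mem hy)
      refine ⟨⟨a, b, ?_, ?_⟩, Units.ext ha⟩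
      · apply RingOfIntegers.ext
        change (a : F) * (b : F) = algebraMap (𝓞 F) F 1
        rw [map_one, ha, hb]
        exact congrArg Subtype.val (Units.mul_inv y)
      · apply RingOfIntegers.ext
        change (b : F) * (a : F) = algebraMap (𝓞 F) F 1
        rw [map_one, ha, hb]
        exact congrArg Subtype.val (Units.inv_mul y))
  have hf : Function.Injective f := fun x y h =>
    Subtype.ext (unitsToField_injective O (congrArg Subtype.val h))
  let e : g.range ≃* (𝓞 F)ˣ := (MonoidHom.ofInjective hg).symm
  have h1 := lift_zRank_eq_of_injective (e.toMonoidHom.comp f) (e.injective.comp hf) (by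
    intro u
    -- The cokernel is torsion: a unit of `𝓞 F` needs no power of `N`, and some power of it is a
    -- unit of `O`.
    obtain ⟨k, hk, y, hy⟩ := hO.exists_unit_eq_pow hN (i := 0) (j := 0) (u := g u)
      (a := (u : 𝓞 F)) (b := ((u⁻¹ : (𝓞 F)ˣ) : 𝓞 F))
      (by rw [pow_zero, one_mul]; rfl) (by rw [pow_zero, one_mul, ← map_inv]; rfl)
    refine ⟨k, hk, ⟨y, ?_⟩, ?_⟩
    · rw [mem_ker_unitsValuation_iff]
      intro v
      have := v.1.valuation_of_unit_eq (K := F) (u ^ k)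
      rw [map_pow, valuationOfNeZero_eq_one_iff] at this
      exact (congrArg (fun z : Fˣ => v.1.valuation F (z : F)) hy).trans this
    · change e _ = _
      rw [MulEquiv.symm_apply_eq]
      exact Subtype.ext (hy.trans (map_pow g u k).symm))
  rw [Cardinal.lift_id, Cardinal.lift_id] at h1
  rw [← h1, hR]

/-- The `S`-unit theorem for an order. -/
theorem zRank_units (hO : IsOrder O) (hN : N ≠ 0) :
    zRank Oˣ = ((Fintype.card (InfinitePlace F) - 1 : ℕ) : Cardinal) +
      (Nat.card (PrimesAbove F N) : Cardinal) := by
  have := finite_primesAbove (F := F) hN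
  rw [zRank_eq_zRank_ker_add _ (hO.exists_unitsValuation_eq_single hN),
    hO.zRank_ker_unitsValuation hN]

end IsOrder

theorem placesAbove_eq (p : ℕ) : placesAbove F p = Nat.card (PrimesAbove F p) := by
  rw [placesAbove, ← Nat.card_coe_set_eq]
  refine Nat.card_congr (FinitePlace.equivHeightOneSpectrum.subtypeEquiv fun v => ?_)
  rw [Set.mem_ofPred_eq, ← FinitePlace.norm_lt_one_iff_mem F, map_natCast (algebraMap (𝓞 F) F),
    FinitePlace.equivHeightOneSpectrum_apply, FinitePlace.norm_embedding_eq]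

/-- Ensures that the natural subtraction `g_p - 1` is not truncated. The norm of `p` is a power of
`p` with positive exponent, so `p` is not a unit of `𝓞 F`. -/
theorem placesAbove_pos {p : ℕ} (hp : p.Prime) : 0 < placesAbove F p := by
  rw [placesAbove_eq]
  have := finite_primesAbove (F := F) hp.ne_zero
  have h : ¬ IsUnit (p : 𝓞 F) := by
    intro h
    have h1 := h.map (Algebra.norm ℤ)
    rw [← map_natCast (algebraMap ℤ (𝓞 F)), Algebra.norm_algebraMap,
      isUnit_pow_iff Module.finrank_pos.ne', Int.isUnit_iff_natAbs_eq] at h1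
    exact hp.ne_one (by simpa using h1)
  obtain ⟨M, hM, hpM⟩ := exists_max_ideal_of_mem_nonunits h
  have hM0 : M ≠ ⊥ := by
    rintro rfl
    rw [Ideal.mem_bot] at hpM
    exact hp.ne_zero (by exact_mod_cast hpM)
  have : Nonempty (PrimesAbove F p) := ⟨⟨⟨M, hM.isPrime, hM0⟩, hpM⟩⟩
  exact Nat.card_pos

/-- A prime ideal containing the product contains some `p ∈ S`, and only one, since two would
generate `1` by Bézout. -/
theorem card_primesAbove_level {S : Finset ℕ} (hS : ∀ p ∈ S, p.Prime) :
    Nat.card (PrimesAbove F (level S)) = ∑ p ∈ S, placesAbove F p := by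
  have hfin (p : S) := finite_primesAbove (F := F) (hS p p.2).ne_zero
  rw [← Finset.sum_coe_sort]
  simp_rw [placesAbove_eq]
  rw [← Nat.card_sigma]
  have hmem (v : HeightOneSpectrum (𝓞 F)) :
      ((level S : ℕ) : 𝓞 F) ∈ v.asIdeal ↔ ∃ p ∈ S, (p : 𝓞 F) ∈ v.asIdeal := by
    rw [level, Nat.cast_prod]
    exact v.isPrime.prod_mem_iff
  refine (Nat.card_congr (Equiv.ofBijective
    (fun x : (p : S) × PrimesAbove F p => (⟨x.2.1, (hmem _).mpr ⟨x.1, x.1.2, x.2.2⟩⟩ :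
      PrimesAbove F (level S))) ⟨?_, ?_⟩)).symm
  · rintro ⟨⟨p, hp⟩, v, hv⟩ ⟨⟨q, hq⟩, w, hw⟩ h
    obtain rfl : v = w := congrArg Subtype.val h
    obtain rfl : p = q := by
      by_contra hpq
      have h2 : IsCoprime (p : ℤ) (q : ℤ) :=
        Nat.isCoprime_iff_coprime.mpr ((Nat.coprime_primes (hS p hp) (hS q hq)).mpr hpq)
      obtain ⟨x, y, hxy⟩ := h2
      have h3 : (x : 𝓞 F) * p + y * q = 1 := by exact_mod_cast congrArg (Int.cast : ℤ → 𝓞 F) hxy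
      refine v.isPrime.ne_top ((Ideal.eq_top_iff_one _).mpr ?_)
      rw [← h3]
      exact add_mem (Ideal.mul_mem_left _ _ hv) (Ideal.mul_mem_left _ _ hw)
    rfl
  · rintro ⟨v, hv⟩
    obtain ⟨p, hp, hpv⟩ := (hmem v).mp hv
    exact ⟨⟨⟨p, hp⟩, v, hpv⟩, rfl⟩

end
-- Norms of units and the final comparison
section
open NumberField
variable {F : Type*} [Field F] [NumberField F]

theorem eq_one_or_eq_neg_one_of_padicValRat_eq_zero {q : ℚ} (hq : q ≠ 0)
    (h : ∀ p : ℕ, p.Prime → padicValRat p q = 0) : q = 1 ∨ q = -1 := by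
  have hnum : q.num.natAbs = 1 := by
    by_contra hne
    obtain ⟨p, hp, hdvd⟩ := Nat.exists_prime_and_dvd hne
    have := Fact.mk hp
    have hden : padicValNat p q.den = 0 :=
      padicValNat.eq_zero_of_not_dvd fun hd => hp.one_lt.ne' <|
        Nat.eq_one_of_dvd_coprimes q.reduced hdvd hd
    have hpos : 1 ≤ padicValNat p q.num.natAbs :=
      one_le_padicValNat_of_dvd (by simpa using hq) hdvd
    have := h p hp
    rw [padicValRat, padicValInt, hden] at this
    omega
  have hden : q.den = 1 := by
    by_contra hne
    obtain ⟨p, hp, hdvd⟩ := Nat.exists_prime_and_dvd hne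
    have := Fact.mk hp
    have hpos : 1 ≤ padicValNat p q.den := one_le_padicValNat_of_dvd q.den_ne_zero hdvd
    have := h p hp
    rw [padicValRat, padicValInt, hnum, padicValNat_one_right] at this
    omega
  have hq' : (q.num : ℚ) = q := Rat.coe_int_num_of_den_eq_one hden
  rw [← hq']
  rcases Int.natAbs_eq_iff.mp hnum with h | h <;> rw [h] <;> simp

variable {N : ℕ} {O : Subalgebra (ZInv N) F}

theorem norm_unit_ne_zero (y : Oˣ) : Algebra.norm ℚ ((y : O) : F) ≠ 0 :=
  Algebra.norm_ne_zero_iff.mpr (unitsToField O y).ne_zero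

theorem norm_unit_inv (y : Oˣ) :
    Algebra.norm ℚ (((y⁻¹ : Oˣ) : O) : F) = (Algebra.norm ℚ ((y : O) : F))⁻¹ := by
  refine eq_inv_of_mul_eq_one_left ?_
  rw [← map_mul, ← map_one (Algebra.norm ℚ (S := F))]
  exact congrArg _ (congrArg Subtype.val (Units.inv_mul y))

/-- The `p`-adic valuations of the norm, for `p ∈ S`. -/
noncomputable def normValuation (O : Subalgebra (ZInv N) F) {S : Finset ℕ}
    (hS : ∀ p ∈ S, p.Prime) : Oˣ →* Multiplicative (S → ℤ) where
  toFun y := Multiplicative.ofAdd fun p => padicValRat p (Algebra.norm ℚ ((y : O) : F))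
  map_one' := by simp; rfl
  map_mul' x y := by
    rw [← ofAdd_add]
    refine congrArg _ (funext fun p => ?_)
    have := Fact.mk (hS p p.2)
    rw [Pi.add_apply, ← padicValRat.mul (norm_unit_ne_zero x) (norm_unit_ne_zero y), ← map_mul]
    rfl

theorem toAdd_normValuation {S : Finset ℕ} (hS : ∀ p ∈ S, p.Prime) (y : Oˣ) (p : S) :
    (normValuation O hS y).toAdd p = padicValRat p (Algebra.norm ℚ ((y : O) : F)) := rfl

/-- The witness is `p` itself, a unit of `O` because `p ∣ N`, with norm `p ^ [F : ℚ]`. -/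
theorem exists_normValuation_eq_single {S : Finset ℕ} (hS : ∀ p ∈ S, p.Prime)
    (hN : N = level S) (p : S) :
    ∃ y : Oˣ, (normValuation O hS y).toAdd p ≠ 0 ∧
      ∀ q ≠ p, (normValuation O hS y).toAdd q = 0 := by
  have hN0 : N ≠ 0 := by
    rw [hN]
    exact Finset.prod_ne_zero_iff.mpr fun q hq => (hS q hq).ne_zero
  have hp0 : ((p : ℕ) : F) ≠ 0 := by exact_mod_cast (hS p p.2).ne_zero
  have hinv : ((p : ℕ) : F)⁻¹ ∈ O := inv_mem_subalgebra_of_dvd_pow hN0 O (j := 1) (by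
    rw [pow_one, hN]
    exact Finset.dvd_prod_of_mem _ p.2)
  let y : Oˣ := ⟨⟨_, natCast_mem O p⟩, ⟨_, hinv⟩, Subtype.ext (mul_inv_cancel₀ hp0),
    Subtype.ext (inv_mul_cancel₀ hp0)⟩
  have hy : Algebra.norm ℚ ((y : O) : F) = ((p : ℕ) : ℚ) ^ Module.finrank ℚ F := by
    rw [← Algebra.norm_algebraMap, map_natCast (algebraMap ℚ F)]
  refine ⟨y, ?_, fun q hqp => ?_⟩
  · have := Fact.mk (hS p p.2)
    rw [toAdd_normValuation, hy, padicValRat.pow,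
      padicValRat.self (hS p p.2).one_lt, mul_one]
    exact_mod_cast Module.finrank_pos.ne'
  · have := Fact.mk (hS q q.2)
    have h : ¬ (q : ℕ) ∣ (p : ℕ) := fun h =>
      hqp (Subtype.ext ((Nat.prime_dvd_prime_iff_eq (hS q q.2) (hS p p.2)).mp h))
    rw [toAdd_normValuation, hy, padicValRat.pow,
      padicValRat.of_nat, padicValNat.eq_zero_of_not_dvd h, Nat.cast_zero, mul_zero]

namespace IsOrder

theorem padicValRat_norm_nonneg (hO : IsOrder O) (hN : N ≠ 0) {p : ℕ} (hp : p.Prime)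
    (hpN : ¬ p ∣ N) {x : F} (hx : x ∈ O) : 0 ≤ padicValRat p (Algebra.norm ℚ x) := by
  have := Fact.mk hp
  rcases eq_or_ne x 0 with rfl | hx0
  -- `padicValRat p 0 = 0` by convention.
  · simp
  obtain ⟨i, a, ha⟩ := hO.exists_pow_mul_integral hN hx
  have h1 : Algebra.norm ℚ (a : F) = (Algebra.norm ℤ a : ℚ) := Algebra.coe_norm_int a |>.symm
  have h2 : ((N : ℚ) ^ i) ^ Module.finrank ℚ F * Algebra.norm ℚ x = (Algebra.norm ℤ a : ℚ) := by
    rw [← h1, ← ha, map_mul, ← Algebra.norm_algebraMap, map_pow (algebraMap ℚ F), map_natCast]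
  have hN' : (N : ℚ) ≠ 0 := by exact_mod_cast hN
  have h3 := congrArg (padicValRat p) h2
  rw [padicValRat.mul (pow_ne_zero _ (pow_ne_zero _ hN')) (Algebra.norm_ne_zero_iff.mpr hx0),
    padicValRat.pow, padicValRat.pow, padicValRat.of_nat,
    padicValNat.eq_zero_of_not_dvd hpN, padicValRat.of_int] at h3
  simp only [Nat.cast_zero, mul_zero, zero_add] at h3
  rw [h3]
  exact Int.natCast_nonneg _

theorem padicValRat_norm_unit (hO : IsOrder O) (hN : N ≠ 0) {p : ℕ} (hp : p.Prime)
    (hpN : ¬ p ∣ N) (y : Oˣ) : padicValRat p (Algebra.norm ℚ ((y : O) : F)) = 0 := by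
  have := Fact.mk hp
  have h1 := hO.padicValRat_norm_nonneg hN hp hpN (y : O).2
  have h2 := hO.padicValRat_norm_nonneg hN hp hpN ((y⁻¹ : Oˣ) : O).2
  rw [norm_unit_inv, padicValRat.inv] at h2
  omega

theorem zRank_units_eq_zRank_normOneUnits_add (hO : IsOrder O) {S : Finset ℕ}
    (hS : ∀ p ∈ S, p.Prime) (hN : N = level S) :
    zRank Oˣ = zRank (normOneUnits O) + (S.card : Cardinal) := by
  have hN0 : N ≠ 0 := by
    rw [hN]
    exact Finset.prod_ne_zero_iff.mpr fun q hq => (hS q hq).ne_zero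
  rw [zRank_eq_zRank_ker_add (normValuation O hS) (exists_normValuation_eq_single hS hN),
    Nat.card_eq_fintype_card, Fintype.card_coe]
  congr 1
  have hle : normOneUnits O ≤ (normValuation O hS).ker := fun y hy => by
    rw [MonoidHom.mem_ker]
    refine funext fun p => ?_
    change padicValRat p (Algebra.norm ℚ ((y : O) : F)) = 0
    rw [mem_normOneUnits_iff.mp hy, padicValRat.one]
  have := lift_zRank_eq_of_injective (Subgroup.inclusion hle) (Subgroup.inclusion_injective hle) (by
    rintro ⟨y, hy⟩
    -- All `p`-adic valuations of the norm vanish, so it is `±1` and squaring gives norm one.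
    refine ⟨2, two_ne_zero, ⟨y ^ 2, ?_⟩, rfl⟩
    have h1 : ∀ p : ℕ, p.Prime → padicValRat p (Algebra.norm ℚ ((y : O) : F)) = 0 := by
      intro p hp
      by_cases hpN : p ∣ N
      · rw [hN, level, hp.prime.dvd_finsetProd_iff] at hpN
        obtain ⟨q, hq, hpq⟩ := hpN
        obtain rfl := (Nat.prime_dvd_prime_iff_eq hp (hS q hq)).mp hpq
        have hy' := MonoidHom.mem_ker.mp hy
        exact congrFun (congrArg Multiplicative.toAdd hy') ⟨p, hq⟩
      · exact hO.padicValRat_norm_unit hN0 hp hpN y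
    rw [mem_normOneUnits_iff, Units.val_pow_eq_pow_val, SubmonoidClass.coe_pow, map_pow]
    exact sq_eq_one_iff.mpr
      (eq_one_or_eq_neg_one_of_padicValRat_eq_zero (norm_unit_ne_zero y) h1))
  simpa using this

end IsOrder

theorem zRank_eigenGroup {n : ℕ} (N : ℕ) (w : Module.Basis (Fin n) ℚ F) :
    Cardinal.lift (zRank (eigenGroup N w)) = zRank (normOneUnits (order N w)) := by
  have := lift_zRank_eq_of_injective (eigenGroupEquiv N w).toMonoidHom
    (eigenGroupEquiv N w).injective fun y =>
      ⟨1, one_ne_zero, (eigenGroupEquiv N w).symm y, by simp⟩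
  rw [← this, Cardinal.lift_uzero]

end
end BasisOrder

theorem proposition2p2 {F : Type*} [Field F] [NumberField F] {n : ℕ}
    (w : Module.Basis (Fin n) ℚ F) (S : Finset ℕ) (hS : ∀ p ∈ S, p.Prime)
    (hur : ∀ p ∈ S, Algebra.IsUnramifiedIn (NumberField.RingOfIntegers F) (Ideal.span {(p : ℤ)}))
    (N : ℕ) (hN : N = BasisOrder.level S) :
    -- (i) `φ(A)` is the unique scalar with `A w = φ(A) w`; `φ` is an injective ring homomorphism
    -- onto an order, which is the multiplier ring of the lattice
    (∀ (A : BasisOrder.eigenAlgebra N w) (c : F),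
      BasisOrder.ActsBy N w A.1 c ↔ c = BasisOrder.phi N w A) ∧
    (∃ f : BasisOrder.eigenAlgebra N w →+* F,
      (∀ A, f A = BasisOrder.phi N w A) ∧ Function.Injective f ∧
      Set.range f = (BasisOrder.order N w : Set F)) ∧
    BasisOrder.IsOrder (BasisOrder.order N w) ∧
    (BasisOrder.order N w : Set F) =
      {x : F | ∀ y ∈ BasisOrder.lattice N w, x * y ∈ BasisOrder.lattice N w} ∧
    -- (ii) the determinant corresponds to the norm
    (∀ A : BasisOrder.eigenAlgebra N w,
      Algebra.norm ℚ (BasisOrder.phi N w A) = ((A.1.det : BasisOrder.ZInv N) : ℚ)) ∧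
    -- (iii) the sequence `1 → Γ → 𝓐ˣ → ℤ[1/N]ˣ` is exact, and `φ` induces `Γ ≃ 𝓞¹`
    (Function.Injective (BasisOrder.eigenGroup.toAlgebra N w).toHomUnits ∧
      (BasisOrder.eigenGroup.toAlgebra N w).toHomUnits.range = (BasisOrder.detUnits N w).ker) ∧
    (∃ e : BasisOrder.eigenGroup N w ≃* BasisOrder.normOneUnits (BasisOrder.order N w),
      ∀ A, (((e A : (BasisOrder.order N w)ˣ) : BasisOrder.order N w) : F) =
        BasisOrder.phi N w (BasisOrder.eigenGroup.toAlgebra N w A)) ∧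
    -- (iv) the ranks; here `#S - 1` is the number of finite places
    BasisOrder.zRank (BasisOrder.order N w)ˣ =
      Cardinal.lift (BasisOrder.zRank (BasisOrder.eigenGroup N w)) + (S.card : Cardinal) ∧
    BasisOrder.zRank (BasisOrder.eigenGroup N w) =
      (((Fintype.card (NumberField.InfinitePlace F) - 1) +
        ∑ p ∈ S, (BasisOrder.placesAbove F p - 1) : ℕ) : Cardinal) := by
  have hN0 : N ≠ 0 := by
    rw [hN]
    exact Finset.prod_ne_zero_iff.mpr fun q hq => (hS q hq).ne_zero
  have hO := BasisOrder.isOrder_order N w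
  have hrank : BasisOrder.zRank (BasisOrder.order N w)ˣ =
      Cardinal.lift (BasisOrder.zRank (BasisOrder.eigenGroup N w)) + (S.card : Cardinal) := by
    rw [BasisOrder.zRank_eigenGroup, hO.zRank_units_eq_zRank_normOneUnits_add hS hN]
  refine ⟨BasisOrder.actsBy_iff_phi,
    ⟨(BasisOrder.phiHom N w : BasisOrder.eigenAlgebra N w →+* F), fun _ => rfl,
      BasisOrder.phi_injective N w, rfl⟩,
    hO, BasisOrder.coe_order_eq_multiplier N w, BasisOrder.norm_phi,
    ⟨BasisOrder.toHomUnits_injective N w, BasisOrder.range_toHomUnits N w⟩,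
    ⟨BasisOrder.eigenGroupEquiv N w, BasisOrder.coe_eigenGroupEquiv N w⟩, hrank, ?_⟩
  have hsum : ∑ p ∈ S, BasisOrder.placesAbove F p =
      ∑ p ∈ S, (BasisOrder.placesAbove F p - 1) + S.card := by
    rw [Finset.card_eq_sum_ones, ← Finset.sum_add_distrib]
    refine Finset.sum_congr rfl fun p hp => ?_
    have := BasisOrder.placesAbove_pos (F := F) (hS p hp)
    omega
  have hunits := hO.zRank_units hN0
  subst hN
  rw [BasisOrder.card_primesAbove_level hS, hsum, Nat.cast_add, ← add_assoc, hrank] at hunits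
  -- The summand `#S` is a finite cardinal, hence cancellable.
  have h := Cardinal.eq_of_add_eq_add_right hunits (Cardinal.natCast_lt_aleph0)
  rw [← Nat.cast_add] at h
  exact Cardinal.lift_injective (h.trans (Cardinal.lift_natCast _).symm)
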